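/- **Conventions.** Hilbert spaces are real. A measure space $(X,\mathcal X,\mu)$ is *$\sigma$-finite standard* if $\mu$ is $\sigma$-finite and there is $X_0\in\mathcal X$ with $\mu(X\setminus X_0)=0$ which is a standard Borel space for the trace $\sigma$-algebra; $\mathcal X^\mu$ is the completion of $\mathcal X$, and "$\mu$-measurable" means measurable with respect to $\mathcal X^\mu$. A *quadratic form* $(Q,\mathcal D(Q))$ on a Hilbert space $H$ is a densely defined, symmetric, positive semi-definite bilinear form; $Q_1(u,v)=Q(u,v)+\langle u,v\rangle$; it is *closed* if $\mathcal D(Q)$ is complete for $Q_1^{1/2}$, and $\mathcal D(Q)_1$ is then $\mathcal D(Q)$ with the inner product $Q_1$. A *Dirichlet form* on $L^2(m)$ is a closed quadratic form with $f^+\wedge 1\in\mathcal D(Q)$ and $Q(f^+\wedge 1)\le Q(f)$ for all $f\in\mathcal D(Q)$. **Measurable fields.** Let $(Z,\mathcal Z,\nu)$ be $\sigma$-finite. A linear space $S\subset\prod_{\zeta} H_\zeta$ is a *space of $\nu$-measurable vector fields* for the family of Hilbert spaces $(H_\zeta)_{\zeta\in Z}$ if (a) $\zeta\mapsto\|u_\zeta\|$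 is $\nu$-measurable for $u\in S$; (b) every $v\in\prod_\zeta H_\zeta$ such that $\zeta\mapsto\langle u_\zeta,v_\zeta\rangle$ is $\nu$-measurable for all $u\in S$ belongs to $S$; (c) there is a sequence $(u_n)$ in $S$ such that $(u_{n,\zeta})_n$ has dense linear span in $H_\zeta$ for every $\zeta$. **Pseudo-disintegrations.** A *pseudo-disintegration* of $\mu$ over $\nu$ is a family $(\mu_\zeta)_{\zeta\in Z}$ of non-zero measures on $(X,\mathcal X)$ such that, for all $A\in\mathcal X$, $\zeta\mapsto\mu_\zeta A$ is $\nu$-measurable and $\mu A=\int_Z\mu_\zeta A\,d\nu(\zeta)$. It is *separated* if there are pairwise disjoint sets $A_\zeta\in\mathcal X^\mu$, $\zeta\in Z$, such that $A_\zeta$ is $\mu_\zeta$-conegligible for $\nu$-a.e. $\zeta$, and such that the map $s\colon\bigcup_\zeta A_\zeta\to Z$ with $s=\zeta$ on $A_\zeta$ is measurable, where $\bigcup_\zeta A_\zeta$ carries the trace of $\mathcal X^\mu$; that is, for each $B\in\mathcal Z$ there is $C\in\mathcal X^\mu$ with $C\cap\bigcup_\zeta A_\zeta=\bigcup_{\zeta\in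 B}A_\zeta$. **Direct integrals.** Let $(X,\mathcal X,\mu)$ be $\sigma$-finite standard, $(Z,\mathcal Z,\nu)$ be $\sigma$-finite with $\mathcal Z$ countably generated, and $(\mu_\zeta)_{\zeta\in Z}$ be a pseudo-disintegration of $\mu$ over $\nu$. For every $\zeta$ let $(E_\zeta,\mathcal D(E_\zeta))$ be a closed quadratic form on $L^2(\mu_\zeta)$. Assume that there are spaces of $\nu$-measurable vector fields $S_H$ for $\zeta\mapsto L^2(\mu_\zeta)$ and $S_Q$ for $\zeta\mapsto\mathcal D(E_\zeta)_1$ with $S_Q\subset S_H$. A field $u\in S_Q$ *represents* $f\in L^2(\mu)$ if $u_\zeta=[f]_{\mu_\zeta}$ for $\nu$-a.e. $\zeta$. The direct integral $(E,\mathcal D(E))$ of $\zeta\mapsto(E_\zeta,\mathcal D(E_\zeta))$, regarded as a form on $L^2(\mu)$ by means of the isometry $[f]_\mu\mapsto(\zeta\mapsto[f]_{\mu_\zeta})$ of $L^2(\mu)$ into the direct integral of $\zeta\mapsto L^2(\mu_\zeta)$ (which is onto in the separated case), is the following: $\mathcal D(E)$ is the set of all $f\in L^2(\mu)$ represented by some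 $u\in S_Q$ with $\int_Z E_{\zeta,1}(u_\zeta)\,d\nu(\zeta)<\infty$, and $E(f,g)=\int_Z E_\zeta(u_\zeta,v_\zeta)\,d\nu(\zeta)$ for such representatives $u,v$ of $f,g$. It is *compatible* with $(\mu_\zeta)_\zeta$ if $S_Q$ is generated by a linear space $\mathcal A$ of $\mu$-square-integrable functions whose classes are dense in $L^2(\mu)$ and contained in $\mathcal D(E)$; here "generated" means that the fields $\zeta\mapsto[f]_{\mu_\zeta}$, $f\in\mathcal A$, belong to $S_Q$ (up to $\nu$-negligible sets of $\zeta$) and that a sequence of them has dense linear span in $\mathcal D(E_\zeta)_1$ for $\nu$-a.e. $\zeta$. **Proposition.** In the above setting, suppose that $(\mu_\zeta)_{\zeta\in Z}$ is separated and that $(E,\mathcal D(E))$ is compatible with $(\mu_\zeta)_{\zeta\in Z}$. Then $(E,\mathcal D(E))$ is a Dirichlet form on $L^2(\mu)$ if and only if $(E_\zeta,\mathcal D(E_\zeta))$ is a Dirichlet form on $L^2(\mu_\zeta)$ for $\nu$-a.e. $\zeta\in Z$. -/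

import Mathlib

open MeasureTheory Filter
open scoped ENNReal

namespace DirInt

noncomputable section

/-! ### Quadratic forms on a real Hilbert space -/

/-- A symmetric, positive semi-definite bilinear form defined on a linear subspace `dom` of `H`.
Density of the domain and closedness are the separate properties below. -/
structure QForm (H : Type*) [NormedAddCommGroup H] [InnerProductSpace ℝ H] where
  /-- the domain -/
  dom : Submodule ℝ H
  /-- the bilinear form -/
  form : dom →ₗ[ℝ] dom →ₗ[ℝ] ℝ
  symm : ∀ u v, form u v = form v u
  nonneg : ∀ u, 0 ≤ form u u

namespace QForm

variable {H : Type*} [NormedAddCommGroup H] [InnerProductSpace ℝ H]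

/-- The domain of `Q` as a space of its own, to be endowed with the inner product
`Q₁(u, v) = Q(u, v) + ⟪u, v⟫`. -/
def Dom (Q : QForm H) : Type _ := Q.dom

instance (Q : QForm H) : AddCommGroup Q.Dom := inferInstanceAs (AddCommGroup Q.dom)
instance (Q : QForm H) : Module ℝ Q.Dom := inferInstanceAs (Module ℝ Q.dom)

/-- The identical inclusion of the domain in the ambient Hilbert space. -/
def incl (Q : QForm H) : Q.Dom →ₗ[ℝ] H := Q.dom.subtype

/-- The form `Q`, on the type `Q.Dom`. -/
def energy (Q : QForm H) : Q.Dom →ₗ[ℝ] Q.Dom →ₗ[ℝ] ℝ := Q.form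

theorem incl_injective (Q : QForm H) : Function.Injective Q.incl := Q.dom.injective_subtype

/-- The inner product `Q₁(u, v) = Q(u, v) + ⟪u, v⟫` on the domain of `Q`. -/
@[reducible]
def core (Q : QForm H) : InnerProductSpace.Core ℝ Q.Dom where
  inner u v := Q.energy u v + inner ℝ (Q.incl u) (Q.incl v)
  conj_inner_symm u v := by
    simp only [conj_trivial]
    rw [real_inner_comm, show Q.energy v u = Q.energy u v from Q.symm v u]
  re_inner_nonneg u := by
    have h : 0 ≤ Q.energy u u := Q.nonneg u
    have h' : 0 ≤ inner ℝ (Q.incl u) (Q.incl u) := real_inner_self_nonneg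
    simpa using add_nonneg h h'
  add_left u v w := by
    simp only [map_add, LinearMap.add_apply, inner_add_left]
    ring
  smul_left u v r := by
    simp only [map_smul, LinearMap.smul_apply, inner_smul_left, conj_trivial, smul_eq_mul]
    ring
  definite u hu := by
    have h : 0 ≤ Q.energy u u := Q.nonneg u
    have h' : 0 ≤ inner ℝ (Q.incl u) (Q.incl u) := real_inner_self_nonneg
    have h0 : inner ℝ (Q.incl u) (Q.incl u) = 0 := by
      have : Q.energy u u + inner ℝ (Q.incl u) (Q.incl u) = 0 := hu
      linarith
    exact Q.incl_injective (by rw [map_zero]; exact inner_self_eq_zero.1 h0)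

instance (Q : QForm H) : NormedAddCommGroup Q.Dom := Q.core.toNormedAddCommGroup
instance (Q : QForm H) : InnerProductSpace ℝ Q.Dom := InnerProductSpace.ofCore Q.core.toCore

theorem inner_def (Q : QForm H) (u v : Q.Dom) :
    inner ℝ u v = Q.energy u v + inner ℝ (Q.incl u) (Q.incl v) := rfl

/-- The form has dense domain. -/
def IsDenselyDefined (Q : QForm H) : Prop := Dense (Q.dom : Set H)

/-- The form is closed: its domain is complete for the norm `Q₁(u, u)^{1/2}`. -/
def IsClosedForm (Q : QForm H) : Prop := CompleteSpace Q.Dom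

end QForm

/-- (Symmetric) Dirichlet forms on `L²(m)`: densely defined closed forms such that, for every `f` in
the domain, `f⁺ ∧ 1` is in the domain and `Q(f⁺ ∧ 1) ≤ Q(f)`. -/
structure IsDirichletForm {X : Type*} [MeasurableSpace X] {m : Measure X}
    (Q : QForm (Lp ℝ 2 m)) : Prop where
  denselyDefined : Q.IsDenselyDefined
  closed : Q.IsClosedForm
  markov : ∀ f : Q.Dom, ∃ g : Q.Dom,
    (Q.incl g =ᵐ[m] fun x => min (max (Q.incl f x) 0) 1) ∧ Q.energy g g ≤ Q.energy f f

/-! ### Measurable fields of Hilbert spaces -/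

section Fields

variable {Z : Type*} [MeasurableSpace Z]

/-- `S` is a space of `ν`-measurable vector fields for the family `H` of Hilbert spaces, that is,
`ζ ↦ H ζ` is a `ν`-measurable field of (separable) Hilbert spaces with underlying space `S`.
For real-valued functions, measurability for the completion of `ν` is `AEMeasurable`. -/
structure IsMeasurableField (ν : Measure Z) {H : Z → Type*} [∀ ζ, NormedAddCommGroup (H ζ)]
    [∀ ζ, InnerProductSpace ℝ (H ζ)] (S : Submodule ℝ (∀ ζ, H ζ)) : Prop where
  aemeasurable_norm : ∀ u ∈ S, AEMeasurable (fun ζ => ‖u ζ‖) ν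
  maximal : ∀ v : ∀ ζ, H ζ,
    (∀ u ∈ S, AEMeasurable (fun ζ => (inner ℝ (u ζ) (v ζ) : ℝ)) ν) → v ∈ S
  fundamental : ∃ u : ℕ → ∀ ζ, H ζ, (∀ n, u n ∈ S) ∧
    ∀ ζ, Dense (Submodule.span ℝ (Set.range fun n => u n ζ) : Set (H ζ))

theorem IsMeasurableField.aemeasurable_inner {ν : Measure Z} {H : Z → Type*}
    [∀ ζ, NormedAddCommGroup (H ζ)] [∀ ζ, InnerProductSpace ℝ (H ζ)]
    {S : Submodule ℝ (∀ ζ, H ζ)} (hS : IsMeasurableField ν S) {u v : ∀ ζ, H ζ}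
    (hu : u ∈ S) (hv : v ∈ S) : AEMeasurable (fun ζ => (inner ℝ (u ζ) (v ζ) : ℝ)) ν := by
  have h1 := hS.aemeasurable_norm _ (S.add_mem hu hv)
  have h2 := hS.aemeasurable_norm _ (S.sub_mem hu hv)
  have h3 := ((h1.mul h1).sub (h2.mul h2)).div_const 4
  refine h3.congr (Eventually.of_forall fun ζ => ?_)
  simp only [Pi.sub_apply, Pi.mul_apply, Pi.add_apply]
  have e1 := norm_add_mul_self_real (u ζ) (v ζ)
  have e2 := norm_sub_mul_self_real (u ζ) (v ζ)
  linarith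

/-- `ζ ↦ (Q ζ, dom (Q ζ))` is a `ν`-measurable field of closed, densely defined quadratic forms, with
underlying spaces `SH` for `ζ ↦ H ζ` and `SQ` for `ζ ↦ dom (Q ζ)`, the latter with the norms
`(Q ζ)₁^{1/2}`, and `SQ ⊆ SH` under the identical inclusions.
(A field of closable forms enters a direct integral only through the closures, here `Q ζ`.) -/
structure IsMeasurableFormField (ν : Measure Z) {H : Z → Type*} [∀ ζ, NormedAddCommGroup (H ζ)]
    [∀ ζ, InnerProductSpace ℝ (H ζ)] (Q : ∀ ζ, QForm (H ζ)) (SH : Submodule ℝ (∀ ζ, H ζ))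
    (SQ : Submodule ℝ (∀ ζ, (Q ζ).Dom)) : Prop where
  denselyDefined : ∀ ζ, (Q ζ).IsDenselyDefined
  closed : ∀ ζ, (Q ζ).IsClosedForm
  field_H : IsMeasurableField ν SH
  field_Q : IsMeasurableField ν SQ
  incl_mem : ∀ u ∈ SQ, (fun ζ => (Q ζ).incl (u ζ)) ∈ SH

end Fields

/-! ### Pseudo-disintegrations -/

section Disintegration

variable {X Z : Type*} [MeasurableSpace X] [MeasurableSpace Z]

/-- A measure is standard if it is concentrated on a measurable set which is a standard Borel space
for the trace σ-algebra (`σ`-finiteness is required separately). -/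
def IsStandardMeasure (μ : Measure X) : Prop :=
  ∃ X₀ : Set X, MeasurableSet X₀ ∧ μ X₀ᶜ = 0 ∧ StandardBorelSpace X₀

/-- Pseudo-disintegrations `(κ ζ)_ζ` of `μ` over `ν`. -/
structure IsPseudoDisintegration (μ : Measure X) (ν : Measure Z) (κ : Z → Measure X) : Prop where
  ne_zero : ∀ ζ, κ ζ ≠ 0
  aemeasurable : ∀ A, MeasurableSet A → AEMeasurable (fun ζ => κ ζ A) ν
  measure_eq : ∀ A, MeasurableSet A → μ A = ∫⁻ ζ, κ ζ A ∂ν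

/-- `(κ ζ)_ζ` is measurably separated: there are pairwise disjoint `μ`-measurable sets `A ζ` with
`A ζ` being `κ ζ`-conegligible for `ν`-a.e. `ζ`, such that the map `⋃ ζ, A ζ → Z` with value `ζ` on
`A ζ` is measurable, where `⋃ ζ, A ζ` carries the trace of the `σ`-algebra of `μ`-measurable sets. -/
def IsMeasurablySeparated (μ : Measure X) (ν : Measure Z) (κ : Z → Measure X) : Prop :=
  ∃ A : Z → Set X,
    (∀ ζ, NullMeasurableSet (A ζ) μ) ∧
    (∀ ζ ζ', ζ ≠ ζ' → Disjoint (A ζ) (A ζ')) ∧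
    (∀ᵐ ζ ∂ν, κ ζ (A ζ)ᶜ = 0) ∧
    ∀ B : Set Z, MeasurableSet B →
      ∃ C : Set X, NullMeasurableSet C μ ∧ C ∩ (⋃ ζ, A ζ) = ⋃ ζ ∈ B, A ζ

theorem IsPseudoDisintegration.ae_ae {μ : Measure X} {ν : Measure Z} {κ : Z → Measure X}
    (hκ : IsPseudoDisintegration μ ν κ) {p : X → Prop} (hp : ∀ᵐ x ∂μ, p x) :
    ∀ᵐ ζ ∂ν, ∀ᵐ x ∂(κ ζ), p x := by
  have hN : μ (toMeasurable μ {x | ¬ p x}) = 0 := by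
    rw [measure_toMeasurable]; exact hp
  have hm := measurableSet_toMeasurable μ {x | ¬ p x}
  rw [hκ.measure_eq _ hm, lintegral_eq_zero_iff' (hκ.aemeasurable _ hm)] at hN
  filter_upwards [hN] with ζ hζ
  exact measure_mono_null (subset_toMeasurable μ _) hζ

/-- The field `u`, in the product of the spaces `L²(κ ζ)`, is the diagonal embedding of `f`, up to
`ν`-equivalence: for `ν`-a.e. `ζ`, the vector `u ζ` is the `κ ζ`-class of `f`.
For `f` square-integrable for `μ`, this says that the class of `u` in the direct integral of
`ζ ↦ L²(κ ζ)` is the image of the class of `f` under the canonical isometry of `L²(μ)` into it. -/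
def IsDiagonal (ν : Measure Z) (κ : Z → Measure X) (u : ∀ ζ, Lp ℝ 2 (κ ζ)) (f : X → ℝ) : Prop :=
  ∀ᵐ ζ ∂ν, u ζ =ᵐ[κ ζ] f

variable {μ : Measure X} {ν : Measure Z} {κ : Z → Measure X}
  {E : ∀ ζ, QForm (Lp ℝ 2 (κ ζ))} {SH : Submodule ℝ (∀ ζ, Lp ℝ 2 (κ ζ))}
  {SQ : Submodule ℝ (∀ ζ, (E ζ).Dom)}

/-- `u ∈ SQ` is a representative of `f ∈ L²(μ)` (identified with its image in the direct integral of
`ζ ↦ L²(κ ζ)`) with `∫ (E ζ)₁(u ζ) dν < ∞`. Recall that `‖u ζ‖ ^ 2 = (E ζ)₁(u ζ)`. -/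
structure IsFiniteEnergyRep (ν : Measure Z) (SQ : Submodule ℝ (∀ ζ, (E ζ).Dom))
    (u : ∀ ζ, (E ζ).Dom) (f : X → ℝ) : Prop where
  mem : u ∈ SQ
  integrable : Integrable (fun ζ => ‖u ζ‖ ^ 2) ν
  isDiagonal : IsDiagonal ν κ (fun ζ => (E ζ).incl (u ζ)) f

theorem IsFiniteEnergyRep.add (hκ : IsPseudoDisintegration μ ν κ)
    (hE : IsMeasurableFormField ν E SH SQ) {u v : ∀ ζ, (E ζ).Dom} {f g : Lp ℝ 2 μ}
    (hu : IsFiniteEnergyRep ν SQ u f) (hv : IsFiniteEnergyRep ν SQ v g) :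
    IsFiniteEnergyRep ν SQ (u + v) (f + g : Lp ℝ 2 μ) where
  mem := SQ.add_mem hu.mem hv.mem
  integrable := by
    refine Integrable.mono' ((hu.integrable.add hv.integrable).const_mul 2)
      ((hE.field_Q.aemeasurable_norm _ (SQ.add_mem hu.mem hv.mem)).pow_const 2).aestronglyMeasurable
      (Eventually.of_forall fun ζ => ?_)
    have h := parallelogram_law_with_norm ℝ (u ζ) (v ζ)
    have h' : 0 ≤ ‖u ζ + v ζ‖ ^ 2 := sq_nonneg _
    simp only [Pi.add_apply, Real.norm_eq_abs, abs_of_nonneg h']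
    nlinarith [sq_nonneg ‖u ζ - v ζ‖]
  isDiagonal := by
    unfold IsDiagonal
    filter_upwards [hu.isDiagonal, hv.isDiagonal, hκ.ae_ae (Lp.coeFn_add f g)] with ζ h1 h2 h3
    simp only [Pi.add_apply, map_add]
    filter_upwards [h1, h2, h3, Lp.coeFn_add ((E ζ).incl (u ζ)) ((E ζ).incl (v ζ))]
      with x e1 e2 e3 e4
    rw [e4, e3, Pi.add_apply, Pi.add_apply, e1, e2]

theorem IsFiniteEnergyRep.smul (hκ : IsPseudoDisintegration μ ν κ) (c : ℝ)
    {u : ∀ ζ, (E ζ).Dom} {f : Lp ℝ 2 μ} (hu : IsFiniteEnergyRep ν SQ u f) :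
    IsFiniteEnergyRep ν SQ (c • u) (c • f : Lp ℝ 2 μ) where
  mem := SQ.smul_mem c hu.mem
  integrable := by
    simpa only [Pi.smul_apply, norm_smul, mul_pow] using hu.integrable.const_mul (‖c‖ ^ 2)
  isDiagonal := by
    unfold IsDiagonal
    filter_upwards [hu.isDiagonal, hκ.ae_ae (Lp.coeFn_smul c f)] with ζ h1 h3
    simp only [Pi.smul_apply, map_smul]
    filter_upwards [h1, h3, Lp.coeFn_smul c ((E ζ).incl (u ζ))] with x e1 e3 e4
    rw [e4, e3, Pi.smul_apply, Pi.smul_apply, e1]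

theorem IsFiniteEnergyRep.zero (hκ : IsPseudoDisintegration μ ν κ) :
    IsFiniteEnergyRep ν SQ (0 : ∀ ζ, (E ζ).Dom) (0 : Lp ℝ 2 μ) where
  mem := SQ.zero_mem
  integrable := by simp
  isDiagonal := by
    unfold IsDiagonal
    filter_upwards [hκ.ae_ae (Lp.coeFn_zero ℝ 2 μ)] with ζ h3
    simp only [Pi.zero_apply, map_zero]
    filter_upwards [h3, Lp.coeFn_zero ℝ 2 (κ ζ)] with x e3 e4
    rw [e4, e3]

/-- Representatives are unique up to `ν`-equivalence. -/
theorem IsFiniteEnergyRep.unique {u v : ∀ ζ, (E ζ).Dom} {f : X → ℝ}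
    (hu : IsFiniteEnergyRep ν SQ u f) (hv : IsFiniteEnergyRep ν SQ v f) : ∀ᵐ ζ ∂ν, u ζ = v ζ := by
  filter_upwards [hu.isDiagonal, hv.isDiagonal] with ζ h1 h2
  exact (E ζ).incl_injective (Lp.ext (h1.trans h2.symm))

theorem IsFiniteEnergyRep.integrable_energy (hE : IsMeasurableFormField ν E SH SQ)
    {u v : ∀ ζ, (E ζ).Dom} {f g : X → ℝ}
    (hu : IsFiniteEnergyRep ν SQ u f) (hv : IsFiniteEnergyRep ν SQ v g) :
    Integrable (fun ζ => (E ζ).energy (u ζ) (v ζ)) ν := by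
  have m1 := hE.field_Q.aemeasurable_inner hu.mem hv.mem
  have m2 := hE.field_H.aemeasurable_inner (hE.incl_mem _ hu.mem) (hE.incl_mem _ hv.mem)
  have heq : ∀ ζ, (E ζ).energy (u ζ) (v ζ) =
      inner ℝ (u ζ) (v ζ) - inner ℝ ((E ζ).incl (u ζ)) ((E ζ).incl (v ζ)) := fun ζ => by
    rw [QForm.inner_def]; ring
  have hle : ∀ ζ (w : (E ζ).Dom), ‖(E ζ).incl w‖ ≤ ‖w‖ := fun ζ w => by
    refine abs_le_of_sq_le_sq' ?_ (norm_nonneg _) |>.2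
    rw [← real_inner_self_eq_norm_sq, ← real_inner_self_eq_norm_sq, QForm.inner_def]
    have h : 0 ≤ (E ζ).energy w w := (E ζ).nonneg w
    linarith
  simp only [heq]
  refine Integrable.mono' (hu.integrable.add hv.integrable)
    (m1.sub m2).aestronglyMeasurable (Eventually.of_forall fun ζ => ?_)
  have a1 := abs_real_inner_le_norm (u ζ) (v ζ)
  have a2 := abs_real_inner_le_norm ((E ζ).incl (u ζ)) ((E ζ).incl (v ζ))
  have a3 := mul_le_mul (hle ζ (u ζ)) (hle ζ (v ζ)) (norm_nonneg _) (norm_nonneg _)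
  rw [Real.norm_eq_abs, Pi.add_apply]
  refine (abs_sub _ _).trans ?_
  nlinarith [sq_nonneg (‖u ζ‖ - ‖v ζ‖)]

/-- The direct integral `E` of `ζ ↦ (E ζ, dom (E ζ))`, as a form on `L²(μ)` through the canonical
identification of `L²(μ)` with a subspace of the direct integral of `ζ ↦ L²(κ ζ)` (the whole of it
if the pseudo-disintegration is measurably separated). Its domain consists of all `f` that
have a representative `u ∈ SQ` with `∫ (E ζ)₁(u ζ) dν < ∞`, and
`E(f, g) = ∫ E ζ (u ζ, v ζ) dν` for representatives `u`, `v` of `f`, `g`. -/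
def directIntegral (hκ : IsPseudoDisintegration μ ν κ) (hE : IsMeasurableFormField ν E SH SQ) :
    QForm (Lp ℝ 2 μ) where
  dom :=
    { carrier := {f | ∃ u, IsFiniteEnergyRep ν SQ u f}
      add_mem' := fun ⟨_, hu⟩ ⟨_, hv⟩ => ⟨_, hu.add hκ hE hv⟩
      zero_mem' := ⟨_, IsFiniteEnergyRep.zero hκ⟩
      smul_mem' := fun c _ ⟨_, hu⟩ => ⟨_, hu.smul hκ c⟩ }
  form := LinearMap.mk₂ ℝ
    (fun f g => ∫ ζ, (E ζ).energy (f.2.choose ζ) (g.2.choose ζ) ∂ν)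
    (fun f₁ f₂ g => by
      rw [← integral_add (f₁.2.choose_spec.integrable_energy hE g.2.choose_spec)
        (f₂.2.choose_spec.integrable_energy hE g.2.choose_spec)]
      refine integral_congr_ae ?_
      filter_upwards [(f₁ + f₂).2.choose_spec.unique
        (f₁.2.choose_spec.add hκ hE f₂.2.choose_spec)] with ζ h
      rw [h, Pi.add_apply, map_add, LinearMap.add_apply])
    (fun c f g => by
      rw [smul_eq_mul, ← integral_const_mul]
      refine integral_congr_ae ?_
      filter_upwards [(c • f).2.choose_spec.unique (f.2.choose_spec.smul hκ c)] with ζ h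
      rw [h, Pi.smul_apply, map_smul, LinearMap.smul_apply, smul_eq_mul])
    (fun f g₁ g₂ => by
      rw [← integral_add (f.2.choose_spec.integrable_energy hE g₁.2.choose_spec)
        (f.2.choose_spec.integrable_energy hE g₂.2.choose_spec)]
      refine integral_congr_ae ?_
      filter_upwards [(g₁ + g₂).2.choose_spec.unique
        (g₁.2.choose_spec.add hκ hE g₂.2.choose_spec)] with ζ h
      rw [h, Pi.add_apply, map_add])
    (fun c f g => by
      rw [smul_eq_mul, ← integral_const_mul]
      refine integral_congr_ae ?_
      filter_upwards [(c • g).2.choose_spec.unique (g.2.choose_spec.smul hκ c)] with ζ h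
      rw [h, Pi.smul_apply, map_smul, smul_eq_mul])
  symm f g := by
    simp only [LinearMap.mk₂_apply]
    exact integral_congr_ae (Eventually.of_forall fun ζ => (E ζ).symm _ _)
  nonneg f := by
    simp only [LinearMap.mk₂_apply]
    exact integral_nonneg fun ζ => (E ζ).nonneg _

/-- The value of the direct integral does not depend on the representatives. -/
theorem directIntegral_form_eq (hκ : IsPseudoDisintegration μ ν κ)
    (hE : IsMeasurableFormField ν E SH SQ) (f g : (directIntegral hκ hE).dom)
    {u v : ∀ ζ, (E ζ).Dom} (hu : IsFiniteEnergyRep ν SQ u (f : Lp ℝ 2 μ))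
    (hv : IsFiniteEnergyRep ν SQ v (g : Lp ℝ 2 μ)) :
    (directIntegral hκ hE).form f g = ∫ ζ, (E ζ).energy (u ζ) (v ζ) ∂ν := by
  refine integral_congr_ae ?_
  filter_upwards [f.2.choose_spec.unique hu, g.2.choose_spec.unique hv] with ζ h1 h2
  exact congrArg₂ (fun a b => (E ζ).energy a b) h1 h2

/-- Compatibility of the direct integral with the pseudo-disintegration: the space `SQ` underlying
`ζ ↦ dom (E ζ)` is generated by the diagonal embedding of a linear space `A` of `μ`-square-integrable
functions (not: classes), dense in `L²(μ)` and contained in the domain of the direct integral.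
Generation means that `SQ` contains the fields of `A`, and that some sequence of these is total in
`ν`-almost every `dom (E ζ)`; `SQ` is then the only space of `ν`-measurable fields containing them. -/
def IsCompatible (μ : Measure X) (ν : Measure Z) (κ : Z → Measure X)
    (E : ∀ ζ, QForm (Lp ℝ 2 (κ ζ))) (SQ : Submodule ℝ (∀ ζ, (E ζ).Dom)) : Prop :=
  ∃ A : Submodule ℝ (X → ℝ),
    (∀ f ∈ A, MemLp f 2 μ) ∧
    Dense {F : Lp ℝ 2 μ | ∃ f ∈ A, F =ᵐ[μ] f} ∧
    (∀ f ∈ A, ∃ u, IsFiniteEnergyRep ν SQ u f) ∧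
    ∃ (a : ℕ → X → ℝ) (u : ℕ → ∀ ζ, (E ζ).Dom),
      (∀ n, a n ∈ A ∧ IsFiniteEnergyRep ν SQ (u n) (a n)) ∧
      ∀ᵐ ζ ∂ν, Dense (Submodule.span ℝ (Set.range fun n => u n ζ) : Set (E ζ).Dom)

end Disintegration

end

end DirInt

/-! The contraction `t ↦ t⁺ ∧ 1` acts pointwise on functions, so it commutes with passing from `f`
to its classes modulo `κ ζ`. Both directions compare the contraction of `f` with the field of
contracted components.

From components to integral, contracting each `u ζ` gives a field whose energies and norms are
dominated by those of `u`; the issue is its measurability. By compatibility the generating functions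
give a total sequence in almost every `L²(κ ζ)`, and their inner products with a diagonal field are
measurable by disintegration. This puts the field in `SH`, and the adjoints of the inclusions carry
that to `SQ` (`IsMeasurableFormField.mem_of_incl_mem`, `IsCompatible.mem_of_isDiagonal`). Closedness
is a Riesz–Fischer argument (`isClosedForm_directIntegral`), with the limit field measurable for the
same reason.

Conversely, the Markov inequality for the direct integral is only an inequality of integrals over
`Z`. Separation turns every measurable `B ⊆ Z` into a set `C ⊆ X` whose indicator cuts fields down
to `B` (`exists_indicator_rep`). Applying the Markov property to the functions cut down by `C` gives
the inequality over every `B`, hence almost everywhere (`ae_markov_of_rep`). Countably many rational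
combinations share one exceptional null set and are dense in almost every domain, and closedness
extends the Markov property to the whole domain (`markov_of_dense`). -/

namespace DirInt

open scoped Topology

/-! ### Fields of Hilbert spaces -/

/-- The linear combination of the `w n` with rational coefficients `c n`. -/
noncomputable def ratComb {V : Type*} [AddCommGroup V] [Module ℝ V] (w : ℕ → V) (c : ℕ →₀ ℚ) : V :=
  c.sum fun n q => (q : ℝ) • w n

theorem ratComb_add {V : Type*} [AddCommGroup V] [Module ℝ V] (w : ℕ → V) (c d : ℕ →₀ ℚ) :
    ratComb w (c + d) = ratComb w c + ratComb w d :=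
  Finsupp.sum_add_index' (by simp) (by intros; rw [Rat.cast_add, add_smul])

theorem ratComb_smul {V : Type*} [AddCommGroup V] [Module ℝ V] (w : ℕ → V) (q : ℚ) (c : ℕ →₀ ℚ) :
    ratComb w (q • c) = (q : ℝ) • ratComb w c := by
  rw [ratComb, Finsupp.sum_smul_index (by simp), ratComb, Finsupp.smul_sum]
  simp only [Rat.cast_mul, mul_smul]

theorem ratComb_mem {V : Type*} [AddCommGroup V] [Module ℝ V] (S : Submodule ℝ V) {w : ℕ → V}
    (hw : ∀ n, w n ∈ S) (c : ℕ →₀ ℚ) : ratComb w c ∈ S :=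
  S.sum_mem fun n _ => S.smul_mem _ (hw n)

theorem ratComb_apply {Z : Type*} {H : Z → Type*} [∀ ζ, AddCommGroup (H ζ)] [∀ ζ, Module ℝ (H ζ)]
    (w : ℕ → ∀ ζ, H ζ) (c : ℕ →₀ ℚ) (ζ : Z) : ratComb w c ζ = ratComb (fun n => w n ζ) c := by
  simp [ratComb, Finsupp.sum]

/-- The closure of the rational combinations is stable under real scalars, by joint continuity of
scalar multiplication. The gain over the span is a countable index set, usable for countable suprema
and for intersections of conull sets. -/
theorem denseRange_ratComb {V : Type*} [NormedAddCommGroup V] [NormedSpace ℝ V] {w : ℕ → V}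
    (hw : Dense (Submodule.span ℝ (Set.range w) : Set V)) : DenseRange (ratComb w) := by
  have hsub : (Submodule.span ℝ (Set.range w) : Set V) ⊆ closure (Set.range (ratComb w)) := by
    intro x hx
    induction hx using Submodule.span_induction with
    | mem x hx =>
      obtain ⟨n, rfl⟩ := hx
      exact subset_closure ⟨Finsupp.single n 1, by simp [ratComb]⟩
    | zero => exact subset_closure ⟨0, by simp [ratComb]⟩
    | add x y _ _ hx hy =>
      refine map_mem_closure₂ continuous_add hx hy ?_
      rintro _ ⟨c, rfl⟩ _ ⟨d, rfl⟩
      exact ⟨c + d, ratComb_add w c d⟩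
    | smul r x _ hx =>
      refine map_mem_closure₂ (f := fun (r : ℝ) (x : V) => r • x) continuous_smul
        (Rat.denseRange_cast (𝕜 := ℝ) r) hx ?_
      rintro _ ⟨q, rfl⟩ _ ⟨c, rfl⟩
      exact ⟨q • c, ratComb_smul w q c⟩
  intro x
  exact closure_minimal hsub isClosed_closure (hw x)

/-- Each term is the truncation at `0` of `‖v‖ ^ 2 - ‖w i - v‖ ^ 2`, which is nearly maximal once `w
i` is close to `v`. Thus a norm is recovered from inner products with a dense family. -/
theorem ofReal_norm_sq_eq_iSup {V ι : Type*} [NormedAddCommGroup V] [InnerProductSpace ℝ V]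
    {w : ι → V} (hw : DenseRange w) (v : V) :
    ENNReal.ofReal (‖v‖ ^ 2) = ⨆ i, ENNReal.ofReal (2 * inner ℝ (w i) v - ‖w i‖ ^ 2) := by
  apply le_antisymm
  · refine le_of_forall_lt fun a ha => ?_
    have hopen : IsOpen {x : V | a < ENNReal.ofReal (2 * inner ℝ x v - ‖x‖ ^ 2)} :=
      isOpen_lt continuous_const (ENNReal.continuous_ofReal.comp (by fun_prop))
    have hv : v ∈ {x : V | a < ENNReal.ofReal (2 * inner ℝ x v - ‖x‖ ^ 2)} := by
      rw [Set.mem_ofPred_eq, real_inner_self_eq_norm_sq]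
      convert ha using 2
      ring
    obtain ⟨i, hi⟩ := hw.exists_mem_open hopen ⟨v, hv⟩
    exact lt_of_lt_of_le hi (le_iSup (fun i => ENNReal.ofReal (2 * inner ℝ (w i) v - ‖w i‖ ^ 2)) i)
  · refine iSup_le fun i => ENNReal.ofReal_le_ofReal ?_
    have h := norm_sub_sq_real (w i) v
    nlinarith [sq_nonneg ‖w i - v‖]

section Fields

variable {Z : Type*} [MeasurableSpace Z] {ν : Measure Z} {H : Z → Type*}
  [∀ ζ, NormedAddCommGroup (H ζ)] [∀ ζ, InnerProductSpace ℝ (H ζ)] {S : Submodule ℝ (∀ ζ, H ζ)}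

/-- A field is measurable as soon as its inner products with a total sequence are. -/
theorem IsMeasurableField.mem_of_total (hS : IsMeasurableField ν S) {w : ℕ → ∀ ζ, H ζ}
    (hw : ∀ n, w n ∈ S)
    (htot : ∀ᵐ ζ ∂ν, Dense (Submodule.span ℝ (Set.range fun n => w n ζ) : Set (H ζ)))
    {v : ∀ ζ, H ζ} (hv : ∀ n, AEMeasurable (fun ζ => (inner ℝ (w n ζ) (v ζ) : ℝ)) ν) : v ∈ S := by
  -- Measurability of norms comes first, as a countable supremum over rational combinations; inner
  -- products with arbitrary members of `S` then follow by polarization.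
  have norm_meas : ∀ x : ∀ ζ, H ζ,
      (∀ n, AEMeasurable (fun ζ => (inner ℝ (w n ζ) (x ζ) : ℝ)) ν) →
      AEMeasurable (fun ζ => ‖x ζ‖ ^ 2) ν := by
    intro x hx
    have hcomb : ∀ c : ℕ →₀ ℚ,
        AEMeasurable (fun ζ => (inner ℝ (ratComb w c ζ) (x ζ) : ℝ)) ν := by
      intro c
      have : (fun ζ => (inner ℝ (ratComb w c ζ) (x ζ) : ℝ)) =
          fun ζ => ∑ n ∈ c.support, (c n : ℝ) * inner ℝ (w n ζ) (x ζ) := by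
        ext ζ
        simp [ratComb, Finsupp.sum, sum_inner, real_inner_smul_left]
      rw [this]
      exact Finset.aemeasurable_fun_sum _ fun n _ => (hx n).const_mul _
    have hsup : AEMeasurable (fun ζ => ⨆ c : ℕ →₀ ℚ,
        ENNReal.ofReal (2 * inner ℝ (ratComb w c ζ) (x ζ) - ‖ratComb w c ζ‖ ^ 2)) ν :=
      AEMeasurable.iSup fun c => (((hcomb c).const_mul 2).sub
        ((hS.aemeasurable_norm _ (ratComb_mem S hw c)).pow_const 2)).ennreal_ofReal
    refine hsup.ennreal_toReal.congr ?_
    filter_upwards [htot] with ζ hζ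
    have hd := denseRange_ratComb hζ
    simp only [ratComb_apply]
    rw [← ofReal_norm_sq_eq_iSup hd (x ζ), ENNReal.toReal_ofReal (sq_nonneg _)]
  refine hS.maximal v fun u hu => ?_
  have h1 := norm_meas (u + v) fun n => by
    simp only [Pi.add_apply, inner_add_right]
    exact (hS.aemeasurable_inner (hw n) hu).add (hv n)
  have h2 := norm_meas u fun n => hS.aemeasurable_inner (hw n) hu
  refine (((h1.sub h2).sub (norm_meas v hv)).div_const 2).congr (Eventually.of_forall fun ζ => ?_)
  have := norm_add_sq_real (u ζ) (v ζ)
  simp only [Pi.sub_apply, Pi.add_apply]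
  linarith

/-- Measurable fields are stable under restriction to a measurable set of parameters. -/
theorem IsMeasurableField.indicator_mem (hS : IsMeasurableField ν S) {u : ∀ ζ, H ζ} (hu : u ∈ S)
    {B : Set Z} (hB : MeasurableSet B) : (fun ζ => B.indicator (fun _ => (1 : ℝ)) ζ • u ζ) ∈ S := by
  refine hS.maximal _ fun w hw => ?_
  simp only [real_inner_smul_right]
  exact ((measurable_const.indicator hB).aemeasurable).mul (hS.aemeasurable_inner hw hu)

end Fields

/-! ### Closed forms and the embedding of their domains -/

namespace QForm

variable {H : Type*} [NormedAddCommGroup H] [InnerProductSpace ℝ H]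

theorem norm_sq_eq (Q : QForm H) (u : Q.Dom) : ‖u‖ ^ 2 = Q.energy u u + ‖Q.incl u‖ ^ 2 := by
  rw [← real_inner_self_eq_norm_sq, ← real_inner_self_eq_norm_sq, inner_def]

theorem energy_self_nonneg (Q : QForm H) (u : Q.Dom) : 0 ≤ Q.energy u u := Q.nonneg u

theorem norm_incl_le (Q : QForm H) (u : Q.Dom) : ‖Q.incl u‖ ≤ ‖u‖ := by
  refine abs_le_of_sq_le_sq' ?_ (norm_nonneg _) |>.2
  linarith [Q.norm_sq_eq u, Q.energy_self_nonneg u]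

/-- The inclusion of the domain, as a continuous linear map. -/
noncomputable def inclL (Q : QForm H) : Q.Dom →L[ℝ] H :=
  Q.incl.mkContinuous 1 fun u => by simpa using Q.norm_incl_le u

@[simp] theorem inclL_apply (Q : QForm H) (u : Q.Dom) : Q.inclL u = Q.incl u := rfl

theorem IsDenselyDefined.denseRange {Q : QForm H} (h : Q.IsDenselyDefined) : DenseRange Q.incl := by
  intro x
  have : Set.range Q.incl = (Q.dom : Set H) := Subtype.range_coe
  rw [this]
  exact h x

variable [CompleteSpace H]

/-- The range of the adjoint of the inclusion is dense. -/
theorem denseRange_adjoint_inclL (Q : QForm H) [CompleteSpace Q.Dom] :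
    DenseRange (ContinuousLinearMap.adjoint Q.inclL) := by
  -- The orthogonal complement of the range of the adjoint is the kernel of the inclusion.
  have h : (ContinuousLinearMap.adjoint Q.inclL).rangeᗮ = ⊥ := by
    rw [ContinuousLinearMap.orthogonal_range, ContinuousLinearMap.adjoint_adjoint]
    exact LinearMap.ker_eq_bot.2 Q.incl_injective
  exact Submodule.dense_iff_topologicalClosure_eq_top.2
    (Submodule.topologicalClosure_eq_top_iff.2 h)

/-- Closed balls of the domain of a closed form are closed in the ambient space. -/
theorem exists_incl_eq_of_tendsto (Q : QForm H) [CompleteSpace Q.Dom] {C : ℝ} {g : ℕ → Q.Dom}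
    (hC : ∀ᶠ k in atTop, ‖g k‖ ≤ C) {x : H} (hx : Tendsto (fun k => Q.incl (g k)) atTop (𝓝 x)) :
    ∃ y : Q.Dom, Q.incl y = x ∧ ‖y‖ ≤ C := by
  -- Banach–Alaoglu gives compactness without any separability assumption; a weak limit along an
  -- ultrafilter finer than `atTop` replaces a subsequence.
  let U : Ultrafilter ℕ := hyperfilter ℕ
  have hU : (U : Filter ℕ) ≤ atTop := Nat.hyperfilter_le_atTop
  let T : Q.Dom → WeakDual ℝ Q.Dom := fun y =>
    StrongDual.toWeakDual (InnerProductSpace.toDual ℝ Q.Dom y)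
  have hT : ∀ y z, T y z = inner ℝ y z := fun y z => InnerProductSpace.toDual_apply_apply ..
  obtain ⟨φ, hφ, hlim⟩ :=
    (WeakDual.isCompact_closedBall (0 : StrongDual ℝ Q.Dom) C).ultrafilter_le_nhds
    (U.map fun k => T (g k)) (by
      rw [le_principal_iff]
      refine hU ?_
      filter_upwards [hC] with k hk
      simpa [T] using hk)
  let y := (InnerProductSpace.toDual ℝ Q.Dom).symm (WeakDual.toStrongDual φ)
  have hy : ∀ z, inner ℝ y z = φ z := fun z => InnerProductSpace.toDual_symm_apply
  refine ⟨y, ?_, ?_⟩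
  -- Testing the weak limit against adjoint images of `h` turns it into a weak limit in `H`, which
  -- must be `x`.
  · refine ext_inner_right ℝ fun h => ?_
    have h1 : Tendsto (fun k => inner ℝ (Q.incl (g k)) h) U (𝓝 (inner ℝ x h)) :=
      (hx.mono_left hU).inner tendsto_const_nhds
    have h2 : Tendsto (fun k => T (g k) (ContinuousLinearMap.adjoint Q.inclL h)) U
        (𝓝 (φ (ContinuousLinearMap.adjoint Q.inclL h))) :=
      ((WeakDual.eval_continuous _).tendsto φ).comp hlim
    have h3 : ∀ z : Q.Dom, inner ℝ z (ContinuousLinearMap.adjoint Q.inclL h) =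
        inner ℝ (Q.incl z) h := fun z => ContinuousLinearMap.adjoint_inner_right ..
    simp only [hT, h3] at h2
    rw [← h3, hy]
    exact tendsto_nhds_unique h2 h1
  · simpa [y] using hφ

end QForm

/-! ### The unit contraction, the Markov property on dense sets, and measurability in the domains -/

/-- Contraction of functions by `t ↦ t⁺ ∧ 1`. -/
def unitContraction (t : ℝ) : ℝ := min (max t 0) 1

theorem lipschitz_unitContraction : LipschitzWith 1 unitContraction :=
  (LipschitzWith.id.max_const 0).min_const 1

theorem unitContraction_zero : unitContraction 0 = 0 := by simp [unitContraction]

/-- The point is that the contraction fixes `0`; this is what allows the Markov property to be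
localized. -/
theorem unitContraction_mul_indicator {X : Type*} (C : Set X) (f : X → ℝ) (x : X) :
    unitContraction (C.indicator (fun _ => (1 : ℝ)) x * f x) =
      C.indicator (fun _ => (1 : ℝ)) x * unitContraction (f x) := by
  by_cases hx : x ∈ C <;> simp [hx, unitContraction_zero]

/-- The Markov property of a closed form follows from the one on a dense set. -/
theorem markov_of_dense {X ι : Type*} [MeasurableSpace X] {m : Measure X} (Q : QForm (Lp ℝ 2 m))
    (hQ : Q.IsClosedForm) {w : ι → Q.Dom} (hw : DenseRange w)
    (h : ∀ i, ∃ g : Q.Dom, (Q.incl g =ᵐ[m] fun x => unitContraction (Q.incl (w i) x)) ∧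
      Q.energy g g ≤ Q.energy (w i) (w i)) (f : Q.Dom) :
    ∃ g : Q.Dom, (Q.incl g =ᵐ[m] fun x => unitContraction (Q.incl f x)) ∧
      Q.energy g g ≤ Q.energy f f := by
  have : CompleteSpace Q.Dom := hQ
  let P : Lp ℝ 2 m → Lp ℝ 2 m := lipschitz_unitContraction.compLp unitContraction_zero
  have hPc : Continuous P := LipschitzWith.continuous_compLp _ _
  have hP : ∀ u, P u =ᵐ[m] fun x => unitContraction (u x) := fun u => LipschitzWith.coeFn_compLp ..
  choose G hG1 hG2 using h
  have hG : ∀ i, Q.incl (G i) = P (Q.incl (w i)) := fun i => Lp.ext ((hG1 i).trans (hP _).symm)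
  obtain ⟨s, hs, hlim⟩ := mem_closure_iff_seq_limit.1 (hw f)
  choose i hi using hs
  obtain rfl : (fun k => w (i k)) = s := funext hi
  have hincl : Tendsto (fun k => Q.incl (w (i k))) atTop (𝓝 (Q.incl f)) :=
    (Q.inclL.continuous.tendsto f).comp hlim
  have hGlim : Tendsto (fun k => Q.incl (G (i k))) atTop (𝓝 (P (Q.incl f))) := by
    simp only [hG]
    exact (hPc.tendsto _).comp hincl
  -- The energies of `G (i k)` need not converge, but these convergent quantities bound `‖G (i k)‖ ^
  -- 2`.
  have hen : Tendsto (fun k => Q.energy (w (i k)) (w (i k)) + ‖Q.incl (G (i k))‖ ^ 2) atTop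
      (𝓝 (Q.energy f f + ‖P (Q.incl f)‖ ^ 2)) := by
    have h1 : ∀ u : Q.Dom, Q.energy u u = ‖u‖ ^ 2 - ‖Q.incl u‖ ^ 2 := fun u => by
      rw [Q.norm_sq_eq]; ring
    simp only [h1]
    exact ((hlim.norm.pow 2).sub (hincl.norm.pow 2)).add (hGlim.norm.pow 2)
  -- The slack `ε` makes the norm bound hold eventually. The vector found does not depend on `ε`,
  -- because the inclusion is injective, so `ε` can be removed at the end.
  have key : ∀ ε > 0, ∃ y : Q.Dom, Q.incl y = P (Q.incl f) ∧ Q.energy y y ≤ Q.energy f f + ε := by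
    intro ε hε
    obtain ⟨y, hy1, hy2⟩ := Q.exists_incl_eq_of_tendsto (g := fun k => G (i k))
      (C := √(Q.energy f f + ‖P (Q.incl f)‖ ^ 2 + ε)) (by
        filter_upwards [hen.eventually_lt_const (lt_add_of_pos_right _ hε)] with k hk
        refine Real.le_sqrt_of_sq_le ?_
        rw [Q.norm_sq_eq]
        linarith [hG2 (i k)]) hGlim
    refine ⟨y, hy1, ?_⟩
    have h2 : 0 ≤ Q.energy f f + ‖P (Q.incl f)‖ ^ 2 + ε := by
      have := Q.energy_self_nonneg f
      positivity
    have h3 := (Real.le_sqrt (norm_nonneg _) h2).1 hy2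
    rw [Q.norm_sq_eq, hy1] at h3
    linarith
  obtain ⟨y, hy, -⟩ := key 1 one_pos
  refine ⟨y, by rw [hy]; exact hP _, le_of_forall_pos_le_add fun ε hε => ?_⟩
  obtain ⟨z, hz, hz'⟩ := key ε hε
  rwa [Q.incl_injective (hy.trans hz.symm)]

/-- A field of vectors in the domains is measurable if it is so in the ambient spaces. -/
theorem IsMeasurableFormField.mem_of_incl_mem {Z : Type*} [MeasurableSpace Z] {ν : Measure Z}
    {H : Z → Type*} [∀ ζ, NormedAddCommGroup (H ζ)] [∀ ζ, InnerProductSpace ℝ (H ζ)]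
    [∀ ζ, CompleteSpace (H ζ)] {Q : ∀ ζ, QForm (H ζ)} {SH : Submodule ℝ (∀ ζ, H ζ)}
    {SQ : Submodule ℝ (∀ ζ, (Q ζ).Dom)} (hQ : IsMeasurableFormField ν Q SH SQ)
    {v : ∀ ζ, (Q ζ).Dom} (hv : (fun ζ => (Q ζ).incl (v ζ)) ∈ SH) : v ∈ SQ := by
  have : ∀ ζ, CompleteSpace (Q ζ).Dom := hQ.closed
  obtain ⟨h, hmem, htot⟩ := hQ.field_H.fundamental
  let G : ∀ ζ, H ζ →L[ℝ] (Q ζ).Dom := fun ζ => ContinuousLinearMap.adjoint (Q ζ).inclL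
  have hG : ∀ ζ x (y : (Q ζ).Dom), inner ℝ (G ζ x) y = inner ℝ x ((Q ζ).incl y) :=
    fun ζ x y => ContinuousLinearMap.adjoint_inner_left ..
  -- The test fields are adjoint images of a total sequence of `SH`: they are total because the
  -- adjoint has dense range, and pairing with them amounts to an inner product in `H ζ`.
  refine hQ.field_Q.mem_of_total (w := fun n ζ => G ζ (h n ζ)) (fun n => ?_)
    (Eventually.of_forall fun ζ => ?_) fun n => ?_
  · refine hQ.field_Q.maximal _ fun u hu => ?_
    simp only [fun ζ => real_inner_comm (G ζ (h n ζ)) (u ζ), hG]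
    exact hQ.field_H.aemeasurable_inner (hmem n) (hQ.incl_mem u hu)
  · refine ((Q ζ).denseRange_adjoint_inclL.dense_image (G ζ).continuous (htot ζ)).mono ?_
    rintro _ ⟨x, hx, rfl⟩
    have := Submodule.mem_map_of_mem (f := (G ζ).toLinearMap) hx
    rw [Submodule.map_span, ← Set.range_comp] at this
    exact this
  · simp only [hG]
    exact hQ.field_H.aemeasurable_inner (hmem n) hv

/-! ### Integration along a pseudo-disintegration and diagonal fields -/

section Disintegration

variable {X Z : Type*} [MeasurableSpace X] [MeasurableSpace Z]
variable {μ : Measure X} {ν : Measure Z} {κ : Z → Measure X}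

/-- The two assertions are proved by one induction, since additivity and monotone convergence of the
outer integral use measurability of the inner ones. -/
theorem IsPseudoDisintegration.lintegral_of_measurable (hκ : IsPseudoDisintegration μ ν κ)
    {f : X → ℝ≥0∞} (hf : Measurable f) :
    AEMeasurable (fun ζ => ∫⁻ x, f x ∂κ ζ) ν ∧ ∫⁻ x, f x ∂μ = ∫⁻ ζ, ∫⁻ x, f x ∂κ ζ ∂ν := by
  refine Measurable.ennreal_induction (motive := fun f => AEMeasurable (fun ζ => ∫⁻ x, f x ∂κ ζ) ν ∧
    ∫⁻ x, f x ∂μ = ∫⁻ ζ, ∫⁻ x, f x ∂κ ζ ∂ν) (fun c s hs => ?_) (fun f g _ hf _ ihf ihg => ?_)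
    (fun f hf hmono ih => ?_) hf
  · simp only [lintegral_indicator_const hs]
    exact ⟨(hκ.aemeasurable s hs).const_mul c,
      by rw [lintegral_const_mul'' _ (hκ.aemeasurable s hs), hκ.measure_eq s hs]⟩
  · simp only [Pi.add_apply, lintegral_add_left hf]
    exact ⟨ihf.1.add ihg.1, by rw [lintegral_add_left' ihf.1, ihf.2, ihg.2]⟩
  · simp only [lintegral_iSup hf hmono]
    exact ⟨AEMeasurable.iSup fun n => (ih n).1, by
      rw [lintegral_iSup' (fun n => (ih n).1)
        (Eventually.of_forall fun ζ m n hmn => lintegral_mono (hmono hmn))]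
      exact iSup_congr fun n => (ih n).2⟩

theorem IsPseudoDisintegration.aemeasurable_lintegral (hκ : IsPseudoDisintegration μ ν κ)
    {f : X → ℝ≥0∞} (hf : AEMeasurable f μ) : AEMeasurable (fun ζ => ∫⁻ x, f x ∂κ ζ) ν := by
  refine (hκ.lintegral_of_measurable hf.measurable_mk).1.congr ?_
  filter_upwards [hκ.ae_ae hf.ae_eq_mk] with ζ h
  exact (lintegral_congr_ae h).symm

theorem IsPseudoDisintegration.lintegral_eq (hκ : IsPseudoDisintegration μ ν κ)
    {f : X → ℝ≥0∞} (hf : AEMeasurable f μ) :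
    ∫⁻ x, f x ∂μ = ∫⁻ ζ, ∫⁻ x, f x ∂κ ζ ∂ν := by
  rw [lintegral_congr_ae hf.ae_eq_mk, (hκ.lintegral_of_measurable hf.measurable_mk).2]
  refine lintegral_congr_ae ?_
  filter_upwards [hκ.ae_ae hf.ae_eq_mk] with ζ h
  exact (lintegral_congr_ae h).symm

/-- Inner products of diagonal fields are measurable. -/
theorem IsDiagonal.aemeasurable_inner (hκ : IsPseudoDisintegration μ ν κ)
    {u v : ∀ ζ, Lp ℝ 2 (κ ζ)} {f g : X → ℝ} (hu : IsDiagonal ν κ u f) (hv : IsDiagonal ν κ v g)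
    (hf : AEMeasurable f μ) (hg : AEMeasurable g μ) :
    AEMeasurable (fun ζ => (inner ℝ (u ζ) (v ζ) : ℝ)) ν := by
  -- Splitting `f * g` into positive and negative parts reduces the claim to lower integrals;
  -- integrability for `κ ζ` holds wherever both factors are classes in `L²(κ ζ)`.
  have h1 := hκ.aemeasurable_lintegral (hf.mul hg).ennreal_ofReal
  have h2 := hκ.aemeasurable_lintegral (hf.mul hg).neg.ennreal_ofReal
  refine (h1.ennreal_toReal.sub h2.ennreal_toReal).congr ?_
  filter_upwards [hu, hv] with ζ h1 h2
  have heq : (fun x => inner ℝ (u ζ x) (v ζ x)) =ᵐ[κ ζ] f * g := by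
    filter_upwards [h1, h2] with x e1 e2
    rw [e1, e2, Pi.mul_apply, RCLike.inner_apply, conj_trivial, mul_comm]
  have hint : Integrable (f * g) (κ ζ) := (L2.integrable_inner (u ζ) (v ζ)).congr heq
  rw [L2.inner_def, integral_congr_ae heq, integral_eq_lintegral_pos_part_sub_lintegral_neg_part hint]
  rfl

/-- The square of the norm of an element of `L²(μ)` is the integral of those of its components. -/
theorem IsDiagonal.norm_sq_eq (hκ : IsPseudoDisintegration μ ν κ)
    {u : ∀ ζ, Lp ℝ 2 (κ ζ)} {f : Lp ℝ 2 μ} (hu : IsDiagonal ν κ u f) :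
    ‖f‖ ^ 2 = ∫ ζ, ‖u ζ‖ ^ 2 ∂ν := by
  have hnorm : ∀ {m : Measure X} (w : Lp ℝ 2 m), ‖w‖ ^ 2 = (∫⁻ x, ‖w x‖ₑ ^ 2 ∂m).toReal := by
    intro m w
    rw [← real_inner_self_eq_norm_sq, L2.inner_def, integral_eq_lintegral_of_nonneg_ae
      (Eventually.of_forall fun x => real_inner_self_nonneg)
      (L2.integrable_inner w w).aestronglyMeasurable]
    congr 1
    refine lintegral_congr fun x => ?_
    rw [real_inner_self_eq_norm_sq, ENNReal.ofReal_pow (norm_nonneg _), ofReal_norm]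
  have hm : AEMeasurable (fun x => ‖f x‖ₑ ^ 2) μ :=
    (Lp.aestronglyMeasurable f).enorm.pow_const 2
  have hfin : ∫⁻ x, ‖f x‖ₑ ^ 2 ∂μ ≠ ∞ := by
    have := (Lp.memLp f).2
    rw [eLpNorm_lt_top_iff_lintegral_rpow_enorm_lt_top two_ne_zero ENNReal.ofNat_ne_top] at this
    simpa using this.ne
  rw [hκ.lintegral_eq hm] at hfin
  rw [hnorm f, hκ.lintegral_eq hm,
    ← integral_toReal (hκ.aemeasurable_lintegral hm)
      (ae_lt_top' (hκ.aemeasurable_lintegral hm) hfin)]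
  refine integral_congr_ae ?_
  filter_upwards [hu] with ζ hζ
  rw [hnorm]
  congr 1
  refine lintegral_congr_ae ?_
  filter_upwards [hζ] with x hx
  rw [hx]

variable {E : ∀ ζ, QForm (Lp ℝ 2 (κ ζ))} {SH : Submodule ℝ (∀ ζ, Lp ℝ 2 (κ ζ))}
  {SQ : Submodule ℝ (∀ ζ, (E ζ).Dom)}

theorem dense_span_incl {H : Type*} [NormedAddCommGroup H] [InnerProductSpace ℝ H] {Q : QForm H}
    (hQ : Q.IsDenselyDefined) {w : ℕ → Q.Dom}
    (hw : Dense (Submodule.span ℝ (Set.range w) : Set Q.Dom)) :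
    Dense (Submodule.span ℝ (Set.range fun n => Q.incl (w n)) : Set H) := by
  refine (hQ.denseRange.dense_image Q.inclL.continuous hw).mono ?_
  rintro _ ⟨x, hx, rfl⟩
  have := Submodule.mem_map_of_mem (f := Q.incl) hx
  rw [Submodule.map_span, ← Set.range_comp] at this
  exact this

/-- Under compatibility, a field of vectors in the domains is measurable as soon as it is the
diagonal embedding of a function. -/
theorem IsCompatible.mem_of_isDiagonal (hcompat : IsCompatible μ ν κ E SQ)
    (hκ : IsPseudoDisintegration μ ν κ) (hE : IsMeasurableFormField ν E SH SQ)
    {v : ∀ ζ, (E ζ).Dom} {f : X → ℝ} (hf : AEMeasurable f μ)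
    (hv : IsDiagonal ν κ (fun ζ => (E ζ).incl (v ζ)) f) : v ∈ SQ := by
  obtain ⟨A, hA, -, -, a, u, hau, htot⟩ := hcompat
  refine hE.mem_of_incl_mem (hE.field_H.mem_of_total (w := fun n ζ => (E ζ).incl (u n ζ))
    (fun n => hE.incl_mem _ (hau n).2.mem) ?_ fun n =>
      (hau n).2.isDiagonal.aemeasurable_inner hκ hv
        (hA _ (hau n).1).aestronglyMeasurable.aemeasurable hf)
  filter_upwards [htot] with ζ hζ
  exact dense_span_incl (hE.denselyDefined ζ) hζ

theorem IsFiniteEnergyRep.congr {u : ∀ ζ, (E ζ).Dom} {f g : X → ℝ}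
    (hκ : IsPseudoDisintegration μ ν κ) (hu : IsFiniteEnergyRep ν SQ u f) (hfg : f =ᵐ[μ] g) :
    IsFiniteEnergyRep ν SQ u g where
  mem := hu.mem
  integrable := hu.integrable
  isDiagonal := by
    unfold IsDiagonal
    filter_upwards [hu.isDiagonal, hκ.ae_ae hfg] with ζ h1 h2
    exact h1.trans h2

/-! ### The direct integral in terms of representatives -/

/-- An element of the domain of the direct integral, as given by a representative. -/
def IsFiniteEnergyRep.toDom (hκ : IsPseudoDisintegration μ ν κ)
    (hE : IsMeasurableFormField ν E SH SQ) {u : ∀ ζ, (E ζ).Dom} {f : Lp ℝ 2 μ}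
    (hu : IsFiniteEnergyRep ν SQ u f) : (directIntegral hκ hE).Dom :=
  (⟨f, u, hu⟩ : (directIntegral hκ hE).dom)

theorem IsFiniteEnergyRep.incl_toDom (hκ : IsPseudoDisintegration μ ν κ)
    (hE : IsMeasurableFormField ν E SH SQ) {u : ∀ ζ, (E ζ).Dom} {f : Lp ℝ 2 μ}
    (hu : IsFiniteEnergyRep ν SQ u f) : (directIntegral hκ hE).incl (hu.toDom hκ hE) = f := rfl

theorem exists_rep (hκ : IsPseudoDisintegration μ ν κ) (hE : IsMeasurableFormField ν E SH SQ)
    (F : (directIntegral hκ hE).Dom) :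
    ∃ u : ∀ ζ, (E ζ).Dom, IsFiniteEnergyRep ν SQ u ((directIntegral hκ hE).incl F) :=
  Subtype.property (p := fun f => f ∈ (directIntegral hκ hE).dom) F

theorem energy_eq (hκ : IsPseudoDisintegration μ ν κ) (hE : IsMeasurableFormField ν E SH SQ)
    (F : (directIntegral hκ hE).Dom) {u : ∀ ζ, (E ζ).Dom}
    (hu : IsFiniteEnergyRep ν SQ u ((directIntegral hκ hE).incl F)) :
    (directIntegral hκ hE).energy F F = ∫ ζ, (E ζ).energy (u ζ) (u ζ) ∂ν :=
  directIntegral_form_eq hκ hE F F hu hu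

theorem norm_sq_eq_integral (hκ : IsPseudoDisintegration μ ν κ)
    (hE : IsMeasurableFormField ν E SH SQ)
    (F : (directIntegral hκ hE).Dom) {u : ∀ ζ, (E ζ).Dom}
    (hu : IsFiniteEnergyRep ν SQ u ((directIntegral hκ hE).incl F)) :
    ‖F‖ ^ 2 = ∫ ζ, ‖u ζ‖ ^ 2 ∂ν := by
  have hint := hu.integrable_energy hE hu
  have hint' : Integrable (fun ζ => ‖(E ζ).incl (u ζ)‖ ^ 2) ν := by
    refine (hu.integrable.sub hint).congr (Eventually.of_forall fun ζ => ?_)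
    simp only [Pi.sub_apply, (E ζ).norm_sq_eq]
    ring
  rw [QForm.norm_sq_eq, energy_eq hκ hE F hu, hu.isDiagonal.norm_sq_eq hκ,
    ← integral_add hint hint']
  simp only [QForm.norm_sq_eq]

end Disintegration

/-- An indicator equals its square; cutting a field thus restricts the domain of integration of its
energy. -/
theorem energy_indicator_smul {Z : Type*} {H : Z → Type*} [∀ ζ, NormedAddCommGroup (H ζ)]
    [∀ ζ, InnerProductSpace ℝ (H ζ)] (Q : ∀ ζ, QForm (H ζ)) (B : Set Z) (u : ∀ ζ, (Q ζ).Dom) :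
    (fun ζ => (Q ζ).energy (B.indicator (fun _ => (1 : ℝ)) ζ • u ζ)
      (B.indicator (fun _ => (1 : ℝ)) ζ • u ζ)) =
      B.indicator fun ζ => (Q ζ).energy (u ζ) (u ζ) := by
  ext ζ
  by_cases hζ : ζ ∈ B <;> simp [hζ]

/-! ### Closedness and density of the direct integral -/

section Disintegration

variable {X Z : Type*} [MeasurableSpace X] [MeasurableSpace Z]
variable {μ : Measure X} {ν : Measure Z} {κ : Z → Measure X}
variable {E : ∀ ζ, QForm (Lp ℝ 2 (κ ζ))} {SH : Submodule ℝ (∀ ζ, Lp ℝ 2 (κ ζ))}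
  {SQ : Submodule ℝ (∀ ζ, (E ζ).Dom)}

theorem IsFiniteEnergyRep.sub (hκ : IsPseudoDisintegration μ ν κ)
    (hE : IsMeasurableFormField ν E SH SQ) {u v : ∀ ζ, (E ζ).Dom} {f g : Lp ℝ 2 μ}
    (hu : IsFiniteEnergyRep ν SQ u f) (hv : IsFiniteEnergyRep ν SQ v g) :
    IsFiniteEnergyRep ν SQ (u - v) (f - g : Lp ℝ 2 μ) := by
  have := hu.add hκ hE (hv.smul hκ (-1))
  simpa only [neg_one_smul, ← sub_eq_add_neg] using this

theorem lintegral_norm_sq_eq (hκ : IsPseudoDisintegration μ ν κ)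
    (hE : IsMeasurableFormField ν E SH SQ)
    (F : (directIntegral hκ hE).Dom) {u : ∀ ζ, (E ζ).Dom}
    (hu : IsFiniteEnergyRep ν SQ u ((directIntegral hκ hE).incl F)) :
    ∫⁻ ζ, ‖u ζ‖ₑ ^ 2 ∂ν = ENNReal.ofReal (‖F‖ ^ 2) := by
  rw [norm_sq_eq_integral hκ hE F hu, ofReal_integral_eq_lintegral_ofReal hu.integrable
    (Eventually.of_forall fun ζ => sq_nonneg _)]
  refine lintegral_congr fun ζ => ?_
  rw [ENNReal.ofReal_pow (norm_nonneg _), ofReal_norm]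

/-- If the squares of the increments of a sequence of fields are geometrically small in the mean,
then the sequence is Cauchy at almost every parameter. -/
theorem ae_cauchySeq_of_lintegral_le {H : Z → Type*} [∀ ζ, NormedAddCommGroup (H ζ)]
    {u : ℕ → ∀ ζ, H ζ} (hm : ∀ n, AEMeasurable (fun ζ => ‖u n ζ - u (n + 1) ζ‖ₑ) ν)
    (hu : ∀ n, ∫⁻ ζ, ‖u n ζ - u (n + 1) ζ‖ₑ ^ 2 ∂ν ≤ (8⁻¹ : ℝ≥0∞) ^ n) :
    ∀ᵐ ζ ∂ν, CauchySeq fun n => u n ζ := by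
  -- The weight `4 ^ n` against the bound `8⁻¹ ^ n` leaves the summable `2⁻¹ ^ n`; where the
  -- weighted sum is a finite `K`, the `n`-th increment is at most `√K * 2⁻¹ ^ n`.
  have hm' : ∀ n, AEMeasurable (fun ζ => (4 : ℝ≥0∞) ^ n * ‖u n ζ - u (n + 1) ζ‖ₑ ^ 2) ν :=
    fun n => ((hm n).pow_const 2).const_mul _
  have hfin : ∫⁻ ζ, ∑' n, (4 : ℝ≥0∞) ^ n * ‖u n ζ - u (n + 1) ζ‖ₑ ^ 2 ∂ν ≠ ∞ := by
    rw [lintegral_tsum hm']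
    refine ne_top_of_le_ne_top (b := ∑' n, (2⁻¹ : ℝ≥0∞) ^ n) ?_ (ENNReal.tsum_le_tsum fun n => ?_)
    · rw [ENNReal.tsum_geometric]
      simp
    · rw [lintegral_const_mul'' _ ((hm n).pow_const 2)]
      refine (mul_le_mul_right (hu n) _).trans ?_
      rw [← mul_pow]
      refine pow_le_pow_left' (le_of_eq ?_) n
      rw [show (8 : ℝ≥0∞) = 4 * 2 by norm_num, ENNReal.mul_inv (by simp) (by simp), ← mul_assoc,
        ENNReal.mul_inv_cancel (by simp) (by simp), one_mul]
  filter_upwards [ae_lt_top' (AEMeasurable.tsum hm') hfin] with ζ hζ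
  set K := ∑' n, (4 : ℝ≥0∞) ^ n * ‖u n ζ - u (n + 1) ζ‖ₑ ^ 2
  refine cauchySeq_of_le_geometric 2⁻¹ √K.toReal (by norm_num) fun n => ?_
  have h1 : (4 : ℝ≥0∞) ^ n * ‖u n ζ - u (n + 1) ζ‖ₑ ^ 2 ≤ K := ENNReal.le_tsum n
  have h2 := ENNReal.toReal_mono hζ.ne h1
  simp only [ENNReal.toReal_mul, ENNReal.toReal_pow, toReal_enorm, ENNReal.toReal_ofNat] at h2
  rw [dist_eq_norm]
  have h3 : ‖u n ζ - u (n + 1) ζ‖ * 2 ^ n ≤ √K.toReal := by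
    refine Real.le_sqrt_of_sq_le (le_trans (le_of_eq ?_) h2)
    rw [mul_pow, ← pow_mul, mul_comm n 2, pow_mul]
    norm_num
    ring
  rwa [inv_pow, ← div_eq_mul_inv, le_div_iff₀ (by positivity)]

/-- The limit field of a sequence of diagonal fields is diagonal. -/
theorem isDiagonal_of_tendsto (hκ : IsPseudoDisintegration μ ν κ)
    {u : ℕ → ∀ ζ, Lp ℝ 2 (κ ζ)} {v : ∀ ζ, Lp ℝ 2 (κ ζ)} {f : ℕ → Lp ℝ 2 μ} {g : Lp ℝ 2 μ}
    (hu : ∀ n, IsDiagonal ν κ (u n) (f n)) (hf : Tendsto f atTop (𝓝 g))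
    (hv : ∀ᵐ ζ ∂ν, Tendsto (fun n => u n ζ) atTop (𝓝 (v ζ))) : IsDiagonal ν κ v g := by
  obtain ⟨ns, hns, hae⟩ := (tendstoInMeasure_of_tendsto_Lp hf).exists_seq_tendsto_ae
  have hdiag : ∀ᵐ ζ ∂ν, ∀ n, u n ζ =ᵐ[κ ζ] f n := ae_all_iff.2 hu
  unfold IsDiagonal
  filter_upwards [hv, hdiag, hκ.ae_ae hae] with ζ h1 h2 h3
  -- This second subsequence depends on `ζ`, which is harmless: along the first one, the `f n`
  -- already converge pointwise to `g`.
  obtain ⟨ms, hms, hae'⟩ := (tendstoInMeasure_of_tendsto_Lp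
    (h1.comp hns.tendsto_atTop)).exists_seq_tendsto_ae
  filter_upwards [hae', h3, ae_all_iff.2 h2] with x e1 e3 e2
  refine tendsto_nhds_unique e1 ?_
  simp only [Function.comp_apply, e2]
  exact e3.comp hms.tendsto_atTop

/-- The direct integral of closed forms is closed. -/
theorem isClosedForm_directIntegral (hκ : IsPseudoDisintegration μ ν κ)
    (hE : IsMeasurableFormField ν E SH SQ) (hcompat : IsCompatible μ ν κ E SQ) :
    (directIntegral hκ hE).IsClosedForm := by
  set D := directIntegral hκ hE
  have : ∀ ζ, CompleteSpace (E ζ).Dom := hE.closed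
  refine Metric.complete_of_convergent_controlled_sequences (fun n => √(8⁻¹ ^ n))
    (fun n => by positivity) fun F hF => ?_
  choose u hu using fun n => exists_rep hκ hE (F n)
  have hdiff : ∀ n m, IsFiniteEnergyRep ν SQ (u n - u m) (D.incl (F n - F m)) := fun n m => by
    rw [map_sub]
    exact (hu n).sub hκ hE (hu m)
  have hmeas : ∀ n m, AEMeasurable (fun ζ => ‖u n ζ - u m ζ‖ₑ) ν := fun n m =>
    ((hE.field_Q.aemeasurable_norm _ (hdiff n m).mem).ennreal_ofReal).congr
      (Eventually.of_forall fun ζ => ofReal_norm _)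
  have hbound : ∀ N n m, N ≤ n → N ≤ m →
      ∫⁻ ζ, ‖u n ζ - u m ζ‖ₑ ^ 2 ∂ν ≤ (8⁻¹ : ℝ≥0∞) ^ N := by
    intro N n m hn hm
    refine (lintegral_norm_sq_eq hκ hE _ (hdiff n m)).trans_le ?_
    have h := hF N n m hn hm
    rw [dist_eq_norm] at h
    have h' := (Real.le_sqrt (norm_nonneg _) (by positivity)).1 h.le
    refine (ENNReal.ofReal_le_ofReal h').trans (le_of_eq ?_)
    rw [ENNReal.ofReal_pow (by norm_num), ENNReal.ofReal_inv_of_pos (by norm_num)]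
    simp
  have hcau := ae_cauchySeq_of_lintegral_le (fun n => hmeas n (n + 1))
    fun n => hbound n n (n + 1) le_rfl n.le_succ
  -- The value `0` off the convergence set is arbitrary. Measurability of `v` comes later, from its
  -- being diagonal.
  have hex : ∀ ζ, ∃ y : (E ζ).Dom, (CauchySeq fun n => u n ζ) →
      Tendsto (fun n => u n ζ) atTop (𝓝 y) := fun ζ => by
    by_cases h : CauchySeq fun n => u n ζ
    · obtain ⟨y, hy⟩ := cauchySeq_tendsto_of_complete h
      exact ⟨y, fun _ => hy⟩
    · exact ⟨0, fun h' => absurd h' h⟩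
  choose v hv' using hex
  have hv : ∀ᵐ ζ ∂ν, Tendsto (fun n => u n ζ) atTop (𝓝 (v ζ)) := hcau.mono fun ζ h => hv' ζ h
  have hFc : CauchySeq F := cauchySeq_of_le_tendsto_0' (fun n : ℕ => √(8⁻¹ ^ n : ℝ))
    (fun n m hnm => (hF n n m le_rfl hnm).le) (by
      simpa using (tendsto_pow_atTop_nhds_zero_of_lt_one (r := (8⁻¹ : ℝ)) (by norm_num)
        (by norm_num)).sqrt)
  obtain ⟨f, hf⟩ := cauchySeq_tendsto_of_complete (D.inclL.uniformContinuous.comp_cauchySeq hFc)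
  have hdiag : IsDiagonal ν κ (fun ζ => (E ζ).incl (v ζ)) f := by
    refine isDiagonal_of_tendsto hκ (fun n => (hu n).isDiagonal) hf ?_
    filter_upwards [hv] with ζ hζ
    exact ((E ζ).inclL.continuous.tendsto _).comp hζ
  have hvmem : v ∈ SQ :=
    hcompat.mem_of_isDiagonal hκ hE (Lp.aestronglyMeasurable f).aemeasurable hdiag
  -- Fatou's lemma in `m` transfers the Cauchy bound to the limit field.
  have hfatou : ∀ n, ∫⁻ ζ, ‖u n ζ - v ζ‖ₑ ^ 2 ∂ν ≤ (8⁻¹ : ℝ≥0∞) ^ n := by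
    intro n
    have h1 : ∫⁻ ζ, ‖u n ζ - v ζ‖ₑ ^ 2 ∂ν ≤
        liminf (fun m => ∫⁻ ζ, ‖u n ζ - u m ζ‖ₑ ^ 2 ∂ν) atTop := by
      refine le_trans (lintegral_mono_ae ?_) (lintegral_liminf_le' fun m => (hmeas n m).pow_const 2)
      filter_upwards [hv] with ζ hζ
      exact ((ENNReal.continuous_pow 2).tendsto _ |>.comp
        (tendsto_const_nhds.sub hζ).enorm).liminf_eq.ge
    refine h1.trans (liminf_le_of_frequently_le' (Eventually.frequently ?_))
    filter_upwards [eventually_ge_atTop n] with m hm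
    exact hbound n n m le_rfl hm
  have hintsub : ∀ n, Integrable (fun ζ => ‖(u n - v) ζ‖ ^ 2) ν := by
    intro n
    refine ⟨((hE.field_Q.aemeasurable_norm _ (SQ.sub_mem (hu n).mem hvmem)).pow_const
      2).aestronglyMeasurable, ?_⟩
    rw [hasFiniteIntegral_iff_enorm]
    simp only [enorm_pow, enorm_norm]
    exact (hfatou n).trans_lt (ENNReal.pow_lt_top (by simp))
  have hrep : ∀ n, IsFiniteEnergyRep ν SQ (u n - v) (D.incl (F n) - f : Lp ℝ 2 μ) := by
    intro n
    refine ⟨SQ.sub_mem (hu n).mem hvmem, hintsub n, ?_⟩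
    unfold IsDiagonal
    filter_upwards [(hu n).isDiagonal, hdiag, hκ.ae_ae (Lp.coeFn_sub (D.incl (F n)) f)]
      with ζ h1 h2 h3
    filter_upwards [h1, h2, h3, Lp.coeFn_sub ((E ζ).incl (u n ζ)) ((E ζ).incl (v ζ))]
      with x e1 e2 e3 e4
    rw [e3, Pi.sub_apply, map_sub, e4, Pi.sub_apply, e1, e2]
    rfl
  -- Finite energy of `v` is obtained from `v = u 0 - (u 0 - v)`.
  have hrepv : IsFiniteEnergyRep ν SQ v f := by
    have := (hu 0).sub hκ hE (hrep 0)
    rwa [sub_sub_cancel, sub_sub_cancel] at this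
  refine ⟨hrepv.toDom hκ hE, ?_⟩
  rw [tendsto_iff_norm_sub_tendsto_zero]
  refine squeeze_zero (fun _ => norm_nonneg _) (fun n => ?_)
    (show Tendsto (fun n : ℕ => √(8⁻¹ ^ n : ℝ)) atTop (𝓝 0) by
      simpa using (tendsto_pow_atTop_nhds_zero_of_lt_one (r := (8⁻¹ : ℝ)) (by norm_num)
        (by norm_num)).sqrt)
  refine Real.le_sqrt_of_sq_le ?_
  have h1 := lintegral_norm_sq_eq hκ hE (F n - hrepv.toDom hκ hE) (u := u n - v) (by
    rw [map_sub]
    exact hrep n)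
  have h2 := h1.symm.trans_le (hfatou n)
  rw [ENNReal.ofReal_le_iff_le_toReal (by simp)] at h2
  simpa using h2

theorem isDenselyDefined_directIntegral (hκ : IsPseudoDisintegration μ ν κ)
    (hE : IsMeasurableFormField ν E SH SQ) (hcompat : IsCompatible μ ν κ E SQ) :
    (directIntegral hκ hE).IsDenselyDefined := by
  obtain ⟨A, -, hdense, hA, -⟩ := hcompat
  refine hdense.mono ?_
  rintro F ⟨f, hf, hFf⟩
  obtain ⟨u, hu⟩ := hA f hf
  exact ⟨u, hu.congr hκ hFf.symm⟩

theorem memLp_unitContraction {f : X → ℝ} {p : ℝ≥0∞} (hf : MemLp f p μ) :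
    MemLp (fun x => unitContraction (f x)) p μ :=
  lipschitz_unitContraction.comp_memLp unitContraction_zero hf

/-! ### From the components to the direct integral -/

/-- If almost all the components are Dirichlet forms, so is the direct integral. -/
theorem isDirichletForm_directIntegral (hκ : IsPseudoDisintegration μ ν κ)
    (hE : IsMeasurableFormField ν E SH SQ) (hcompat : IsCompatible μ ν κ E SQ)
    (h : ∀ᵐ ζ ∂ν, IsDirichletForm (E ζ)) : IsDirichletForm (directIntegral hκ hE) where
  denselyDefined := isDenselyDefined_directIntegral hκ hE hcompat
  closed := isClosedForm_directIntegral hκ hE hcompat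
  markov F := by
    obtain ⟨u, hu⟩ := exists_rep hκ hE F
    set f := (directIntegral hκ hE).incl F
    have hex : ∀ ζ, ∃ g : (E ζ).Dom, IsDirichletForm (E ζ) →
        ((E ζ).incl g =ᵐ[κ ζ] fun x => unitContraction ((E ζ).incl (u ζ) x)) ∧
        (E ζ).energy g g ≤ (E ζ).energy (u ζ) (u ζ) := fun ζ => by
      by_cases hζ : IsDirichletForm (E ζ)
      · obtain ⟨g, hg⟩ := hζ.markov (u ζ)
        exact ⟨g, fun _ => hg⟩
      · exact ⟨0, fun h' => absurd h' hζ⟩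
    choose v hv using hex
    have hg : MemLp (fun x => unitContraction (f x)) 2 μ := memLp_unitContraction (Lp.memLp f)
    have hdiag : IsDiagonal ν κ (fun ζ => (E ζ).incl (v ζ)) (fun x => unitContraction (f x)) := by
      unfold IsDiagonal
      filter_upwards [h, hu.isDiagonal] with ζ h1 h2
      filter_upwards [(hv ζ h1).1, h2] with x e1 e2
      rw [e1, e2]
    have hmem := hcompat.mem_of_isDiagonal hκ hE hg.aestronglyMeasurable.aemeasurable hdiag
    have hrep : IsFiniteEnergyRep ν SQ v (hg.toLp : Lp ℝ 2 μ) := by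
      refine IsFiniteEnergyRep.congr hκ ⟨hmem, ?_, hdiag⟩ hg.coeFn_toLp.symm
      refine hu.integrable.mono'
        ((hE.field_Q.aemeasurable_norm _ hmem).pow_const 2).aestronglyMeasurable ?_
      filter_upwards [h] with ζ h1
      -- The contraction does not increase absolute values, so the `L²` part of the norm is
      -- dominated as well as the energy.
      have hle : ‖(E ζ).incl (v ζ)‖ ≤ ‖(E ζ).incl (u ζ)‖ := by
        refine Lp.norm_le_norm_of_ae_le ?_
        filter_upwards [(hv ζ h1).1] with x e1
        rw [e1]
        simpa [unitContraction_zero] using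
          lipschitz_unitContraction.norm_sub_le ((E ζ).incl (u ζ) x) 0
      rw [Real.norm_eq_abs, abs_of_nonneg (sq_nonneg _), QForm.norm_sq_eq, QForm.norm_sq_eq]
      exact add_le_add (hv ζ h1).2 (pow_le_pow_left₀ (norm_nonneg _) hle 2)
    refine ⟨hrep.toDom hκ hE, hg.coeFn_toLp, ?_⟩
    rw [energy_eq hκ hE F hu, energy_eq hκ hE (hrep.toDom hκ hE) hrep]
    refine integral_mono_ae (hrep.integrable_energy hE hrep) (hu.integrable_energy hE hu) ?_
    filter_upwards [h] with ζ h1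
    exact (hv ζ h1).2

/-! ### From the direct integral to the components -/

/-- Multiplication with the indicator of a saturated set of a separated pseudo-disintegration. -/
theorem exists_indicator_rep (hE : IsMeasurableFormField ν E SH SQ)
    (hsep : IsMeasurablySeparated μ ν κ) {B : Set Z} (hB : MeasurableSet B) : ∃ C : Set X, NullMeasurableSet C μ ∧
      ∀ {u : ∀ ζ, (E ζ).Dom} {f : X → ℝ}, IsFiniteEnergyRep ν SQ u f →
        IsFiniteEnergyRep ν SQ (fun ζ => B.indicator (fun _ => (1 : ℝ)) ζ • u ζ)
          (fun x => C.indicator (fun _ => (1 : ℝ)) x * f x) := by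
  obtain ⟨A, -, hdisj, hA, hC⟩ := hsep
  obtain ⟨C, hCm, hCA⟩ := hC B hB
  refine ⟨C, hCm, fun {u f} hu => ?_⟩
  have hmem := hE.field_Q.indicator_mem hu.mem hB
  refine ⟨hmem, ?_, ?_⟩
  · refine hu.integrable.mono'
      ((hE.field_Q.aemeasurable_norm _ hmem).pow_const 2).aestronglyMeasurable
      (Eventually.of_forall fun ζ => ?_)
    by_cases hζ : ζ ∈ B <;> simp [hζ]
  · unfold IsDiagonal
    filter_upwards [hA, hu.isDiagonal] with ζ h1 h2
    have h1' : ∀ᵐ x ∂κ ζ, x ∈ A ζ := h1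
    -- By disjointness, membership in `C` is constant on `A ζ`, which carries `κ ζ`; so the
    -- indicator of `C` acts there as a scalar.
    have hind : ∀ x ∈ A ζ, (x ∈ C ↔ ζ ∈ B) := by
      intro x hx
      have hxU : x ∈ ⋃ ζ, A ζ := Set.mem_iUnion.2 ⟨ζ, hx⟩
      constructor
      · intro hxC
        have : x ∈ ⋃ ζ ∈ B, A ζ := hCA ▸ ⟨hxC, hxU⟩
        obtain ⟨ζ', hζ', hx'⟩ := Set.mem_iUnion₂.1 this
        by_contra hne
        exact Set.disjoint_left.1 (hdisj ζ ζ' fun h => hne (h ▸ hζ')) hx hx'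
      · intro hζ
        have : x ∈ C ∩ ⋃ ζ, A ζ := hCA ▸ Set.mem_iUnion₂.2 ⟨ζ, hζ, hx⟩
        exact this.1
    simp only [map_smul]
    filter_upwards [h1', h2, Lp.coeFn_smul (B.indicator (fun _ => (1 : ℝ)) ζ) ((E ζ).incl (u ζ))]
      with x e1 e2 e3
    rw [e3, Pi.smul_apply, e2, smul_eq_mul]
    by_cases hζ : ζ ∈ B
    · simp [hζ, (hind x e1).2 hζ]
    · simp [hζ, mt (hind x e1).1 hζ]

/-- The Markov property of the direct integral, localized by separation. -/
theorem ae_markov_of_rep (hκ : IsPseudoDisintegration μ ν κ)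
    (hE : IsMeasurableFormField ν E SH SQ) (hsep : IsMeasurablySeparated μ ν κ)
    (h : IsDirichletForm (directIntegral hκ hE)) {u : ∀ ζ, (E ζ).Dom} {f : Lp ℝ 2 μ}
    (hu : IsFiniteEnergyRep ν SQ u f) :
    ∀ᵐ ζ ∂ν, ∃ g : (E ζ).Dom,
      ((E ζ).incl g =ᵐ[κ ζ] fun x => unitContraction ((E ζ).incl (u ζ) x)) ∧
      (E ζ).energy g g ≤ (E ζ).energy (u ζ) (u ζ) := by
  obtain ⟨G, hG, -⟩ := h.markov (hu.toDom hκ hE)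
  obtain ⟨v, hv⟩ := exists_rep hκ hE G
  rw [hu.incl_toDom hκ hE] at hG
  have hv' : IsFiniteEnergyRep ν SQ v fun x => unitContraction (f x) := hv.congr hκ hG
  have hle : (fun ζ => (E ζ).energy (v ζ) (v ζ)) ≤ᵐ[ν] fun ζ => (E ζ).energy (u ζ) (u ζ) := by
    refine ae_le_of_forall_setIntegral_le (hv.integrable_energy hE hv)
      (hu.integrable_energy hE hu) fun B hB _ => ?_
    obtain ⟨C, hC, hrep⟩ := exists_indicator_rep hE hsep hB
    have hCf : MemLp (fun x => C.indicator (fun _ => (1 : ℝ)) x * f x) 2 μ := by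
      refine (Lp.memLp f).mono ((aestronglyMeasurable_const.indicator₀ hC).mul
        (Lp.aestronglyMeasurable f)) (Eventually.of_forall fun x => ?_)
      by_cases hx : x ∈ C <;> simp [hx]
    have huB : IsFiniteEnergyRep ν SQ (fun ζ => B.indicator (fun _ => (1 : ℝ)) ζ • u ζ)
        (hCf.toLp : Lp ℝ 2 μ) := (hrep hu).congr hκ hCf.coeFn_toLp.symm
    -- `K` is the contraction of the cut function, hence the cut of the contraction, so `v` cut down
    -- to `B` represents it. The inequality is then one of integrals over `B`.
    obtain ⟨K, hK, hKle⟩ := h.markov (huB.toDom hκ hE)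
    rw [huB.incl_toDom hκ hE] at hK
    have hvB : IsFiniteEnergyRep ν SQ (fun ζ => B.indicator (fun _ => (1 : ℝ)) ζ • v ζ)
        ((directIntegral hκ hE).incl K) := by
      refine (hrep hv').congr hκ ?_
      filter_upwards [hK, hCf.coeFn_toLp] with x e1 e2
      rw [e1, e2, ← unitContraction_mul_indicator, unitContraction]
    rw [energy_eq hκ hE K hvB, energy_eq hκ hE (huB.toDom hκ hE) huB, energy_indicator_smul,
      energy_indicator_smul, integral_indicator hB, integral_indicator hB] at hKle
    exact hKle
  filter_upwards [hle, hu.isDiagonal, hv'.isDiagonal] with ζ h1 h2 h3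
  refine ⟨v ζ, ?_, h1⟩
  filter_upwards [h2, h3] with x e2 e3
  rw [e3, e2]

/-- If the direct integral is a Dirichlet form, so are almost all the components. -/
theorem ae_isDirichletForm (hκ : IsPseudoDisintegration μ ν κ)
    (hE : IsMeasurableFormField ν E SH SQ) (hsep : IsMeasurablySeparated μ ν κ)
    (hcompat : IsCompatible μ ν κ E SQ) (h : IsDirichletForm (directIntegral hκ hE)) :
    ∀ᵐ ζ ∂ν, IsDirichletForm (E ζ) := by
  obtain ⟨A, hA, -, -, a, u, hau, htot⟩ := hcompat
  have hrep : ∀ n, IsFiniteEnergyRep ν SQ (u n) ((hA _ (hau n).1).toLp : Lp ℝ 2 μ) := fun n =>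
    (hau n).2.congr hκ (hA _ (hau n).1).coeFn_toLp.symm
  have hcomb : ∀ c : ℕ →₀ ℚ, ∃ f : Lp ℝ 2 μ, IsFiniteEnergyRep ν SQ (ratComb u c) f := by
    intro c
    refine Finset.sum_induction _ (fun u => ∃ f : Lp ℝ 2 μ, IsFiniteEnergyRep ν SQ u f)
      (fun _ _ ⟨_, h1⟩ ⟨_, h2⟩ => ⟨_, h1.add hκ hE h2⟩) ⟨_, IsFiniteEnergyRep.zero hκ⟩
      fun n _ => ⟨_, (hrep n).smul hκ _⟩
  -- The null set of `ae_markov_of_rep` depends on the field; rational coefficients keep the number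
  -- of fields countable.
  have hae := ae_all_iff.2 fun c => ae_markov_of_rep hκ hE hsep h (hcomb c).choose_spec
  filter_upwards [hae, htot] with ζ h1 h2
  refine ⟨hE.denselyDefined ζ, hE.closed ζ, ?_⟩
  refine markov_of_dense (E ζ) (hE.closed ζ) (denseRange_ratComb h2) fun c => ?_
  rw [← ratComb_apply]
  exact h1 c

end Disintegration

end DirInt

theorem proposition2p13 {X Z : Type*} [MeasurableSpace X] [MeasurableSpace Z]
    [MeasurableSpace.CountablyGenerated Z]
    (μ : MeasureTheory.Measure X) [MeasureTheory.SigmaFinite μ] (hμ : DirInt.IsStandardMeasure μ)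
    (ν : MeasureTheory.Measure Z) [MeasureTheory.SigmaFinite ν]
    (κ : Z → MeasureTheory.Measure X)
    (hκ : DirInt.IsPseudoDisintegration μ ν κ)
    (hsep : DirInt.IsMeasurablySeparated μ ν κ)
    (E : ∀ ζ, DirInt.QForm (MeasureTheory.Lp ℝ 2 (κ ζ)))
    (SH : Submodule ℝ (∀ ζ, MeasureTheory.Lp ℝ 2 (κ ζ)))
    (SQ : Submodule ℝ (∀ ζ, (E ζ).Dom))
    (hE : DirInt.IsMeasurableFormField ν E SH SQ)
    (hcompat : DirInt.IsCompatible μ ν κ E SQ) :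
    DirInt.IsDirichletForm (DirInt.directIntegral hκ hE) ↔
      ∀ᵐ ζ ∂ν, DirInt.IsDirichletForm (E ζ) :=
  ⟨DirInt.ae_isDirichletForm hκ hE hsep hcompat,
    DirInt.isDirichletForm_directIntegral hκ hE hcompat⟩
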